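/- **Theorem 3.3 (Global Existence).** Let $\mathscr P_2(\mathbb R)$ be the set of Borel probability measures on $\mathbb R$ with finite second moment. For $\mu\in\mathscr P_2(\mathbb R)$ call $X\in L^2(\mathbb R,\mu)$ *monotone* if the support $\Gamma$ of the push-forward $(\mathrm{id},X)\#\mu$ is a monotone set, i.e. $(m_1-m_2)(x_1-x_2)\ge 0$ for all $(m_1,x_1),(m_2,x_2)\in\Gamma$; let $\mathcal C=\mathcal C_\mu\subset L^2(\mathbb R,\mu)$ be the cone of monotone maps. Let $\bar\varrho\in\mathscr P_2(\mathbb R)$ and $\bar v\in L^2(\mathbb R,\bar\varrho)$. There exist $\mu\in\mathscr P_2(\mathbb R)$ and $\bar X\in\mathcal C_\mu$ with $\bar X\#\mu=\bar\varrho$. Moreover, for every $\mu\in\mathscr P_2(\mathbb R)$ and every $\bar X\in\mathcal C_\mu$ with $\bar X\#\mu=\bar\varrho$, the following holds. 1. $\bar X$ is the only element of $\mathcal C$ that pushes $\mu$ forward to $\bar\varrho$. 2. Put $\bar V:=\bar v\circ\bar X\in L^2(\mathbb R,\mu)$. For every $t\in\mathbb R$ the metric projection $X_t:=P_{\mathcal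 C}(\bar X+t\bar V)$, i.e. the point of $\mathcal C$ nearest to $\bar X+t\bar V$ in $L^2(\mathbb R,\mu)$, exists and is unique. Put $\varrho_t:=X_t\#\mu$. 3. For a.e. $t\in\mathbb R$, the map $t\mapsto X_t\in L^2(\mathbb R,\mu)$ is (strongly) differentiable at $t$, and $V_t:=\dot X_t$ is the orthogonal projection of $\bar V$ onto $H_{X_t}$, the closure in $L^2(\mathbb R,\mu)$ of $\{\varphi\circ X_t:\varphi\in C_c^\infty(\mathbb R)\}$. 4. There are functions $v_t:\mathbb R\to\mathbb R$ $(t\in\mathbb R)$ such that $v_t\in L^2(\mathbb R,\varrho_t)$ and $V_t=v_t\circ X_t$ $\mu$-a.e., for a.e. $t\in\mathbb R$, and such that $(\varrho_t,v_t)$ is a weak solution in $[0,\infty)\times\mathbb R$ of $$\partial_t\varrho+\partial_x(\varrho v)=0,\qquad \partial_t(\varrho v)+\partial_x(\varrho v^2)=0$$ with initial data $(\bar\varrho,\bar v)$. That is: $\varrho_t$ is a probability measure for all $t\ge0$ and $v_t\in L^2(\mathbb R,\varrho_t)$ for a.e. $t>0$; for all $\varphi\in C_c^\infty(\mathbb R^2)$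 and $k\in\{0,1,2\}$ the function $t\mapsto\int_{\mathbb R}\varphi(t,x)\,v_t(x)^k\,\varrho_t(dx)$ is integrable on $(0,\infty)$; and for all $\varphi\in C_c^\infty(\mathbb R^2)$ $$-\int_{\mathbb R}\varphi(0,x)\,\bar\varrho(dx)=\int_0^\infty\!\!\int_{\mathbb R}\big(\partial_t\varphi(t,x)+v_t(x)\,\partial_x\varphi(t,x)\big)\,\varrho_t(dx)\,dt,$$ $$-\int_{\mathbb R}\varphi(0,x)\,\bar v(x)\,\bar\varrho(dx)=\int_0^\infty\!\!\int_{\mathbb R}\big(\partial_t\varphi(t,x)+v_t(x)\,\partial_x\varphi(t,x)\big)\,v_t(x)\,\varrho_t(dx)\,dt.$$ -/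

import Mathlib

open MeasureTheory Set
open scoped ContDiff

noncomputable section

namespace PGD

/-- Borel probability measures on the real line with finite second moment. -/
structure IsP2 (ν : Measure ℝ) : Prop where
  isProbabilityMeasure : IsProbabilityMeasure ν
  secondMoment : Integrable (fun x : ℝ => x ^ 2) ν

/-- Monotone subsets of the plane. -/
def IsMonotoneSet (Γ : Set (ℝ × ℝ)) : Prop :=
  ∀ p ∈ Γ, ∀ q ∈ Γ, 0 ≤ (p.1 - q.1) * (p.2 - q.2)

/-- The transport plan induced by `X`: the push-forward of `μ` under `m ↦ (m, X m)`. -/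
def transportPlan (μ : Measure ℝ) (X : ℝ → ℝ) : Measure (ℝ × ℝ) :=
  μ.map (fun m => (m, X m))

/-- The cone of monotone maps in `L²(ℝ, μ)`: those `X` for which the (topological) support of
the induced transport plan is a monotone set. -/
def monotoneCone (μ : Measure ℝ) : Set (Lp ℝ 2 μ) :=
  {X | IsMonotoneSet (transportPlan μ X).support}

/-- `Z` is a metric projection of `Y` onto `C`: a point of `C` that realizes the distance. -/
def IsMetricProj {H : Type*} [NormedAddCommGroup H] (C : Set H) (Y Z : H) : Prop :=
  Z ∈ C ∧ ‖Y - Z‖ = ⨅ W : C, ‖Y - (W : H)‖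

/-- The Lagrangian velocity `v ∘ X` as an element of `L²(ℝ, μ)`, where `X` pushes `μ` forward to
`ν` and `v ∈ L²(ℝ, ν)`. -/
def lagrangianVelocity {μ ν : Measure ℝ} (X : Lp ℝ 2 μ) (hX : MeasurePreserving X μ ν)
    {v : ℝ → ℝ} (hv : MemLp v 2 ν) : Lp ℝ 2 μ :=
  (hv.comp_measurePreserving hX).toLp (v ∘ X)

/-- The subspace of all `φ ∘ X`, with `φ` smooth and compactly supported, in `L²(ℝ, μ)`. -/
def testCompositions {μ : Measure ℝ} (X : Lp ℝ 2 μ) : Submodule ℝ (Lp ℝ 2 μ) where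
  carrier := {W | ∃ φ : ℝ → ℝ, ContDiff ℝ ∞ φ ∧ HasCompactSupport φ ∧
    (W : ℝ → ℝ) =ᵐ[μ] fun m => φ (X m)}
  zero_mem' := ⟨0, contDiff_const, HasCompactSupport.zero, Lp.coeFn_zero ℝ 2 μ⟩
  add_mem' := by
    rintro W₁ W₂ ⟨φ₁, h₁, c₁, e₁⟩ ⟨φ₂, h₂, c₂, e₂⟩
    refine ⟨φ₁ + φ₂, h₁.add h₂, c₁.add c₂, ?_⟩
    filter_upwards [Lp.coeFn_add W₁ W₂, e₁, e₂] with m h k₁ k₂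
    exact h.trans (congrArg₂ (· + ·) k₁ k₂)
  smul_mem' := by
    rintro c W ⟨φ, h, hc, e⟩
    refine ⟨fun x => c * φ x, contDiff_const.mul h, hc.mul_left, ?_⟩
    filter_upwards [Lp.coeFn_smul c W, e] with m h k
    exact h.trans (congrArg (c * ·) k)

/-- The closure in `L²(ℝ, μ)` of the set of all `φ ∘ X`, with `φ` smooth and compactly
supported. -/
def closedSpan {μ : Measure ℝ} (X : Lp ℝ 2 μ) : Submodule ℝ (Lp ℝ 2 μ) :=
  (testCompositions X).topologicalClosure

instance {μ : Measure ℝ} (X : Lp ℝ 2 μ) : CompleteSpace (closedSpan X) :=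
  (Submodule.isClosed_topologicalClosure _).completeSpace_coe

/-- Test functions on `[0, ∞) × ℝ`: restrictions of smooth compactly supported functions
`(t, x) ↦ φ (t, x)` on the plane (they need not vanish at `t = 0`). -/
def IsTestFunction (φ : ℝ × ℝ → ℝ) : Prop :=
  ContDiff ℝ ∞ φ ∧ HasCompactSupport φ

/-- The partial derivative in time. -/
def dt (φ : ℝ × ℝ → ℝ) (t x : ℝ) : ℝ := deriv (fun s => φ (s, x)) t

/-- The partial derivative in space. -/
def dx (φ : ℝ × ℝ → ℝ) (t x : ℝ) : ℝ := deriv (fun y => φ (t, y)) x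

/-- `(ϱ, v)` is a weak (distributional) solution in `[0, ∞) × ℝ` of the pressureless gas dynamics
equations `∂ₜϱ + ∂ₓ(ϱv) = 0`, `∂ₜ(ϱv) + ∂ₓ(ϱv²) = 0` with initial data `(ϱ₀, v₀)`.
Here `ϱ t` are probability measures, and `v t` has finite kinetic energy for almost every `t`. -/
structure IsWeakSolution (ϱ : ℝ → Measure ℝ) (v : ℝ → ℝ → ℝ) (ϱ₀ : Measure ℝ) (v₀ : ℝ → ℝ) :
    Prop where
  isProbabilityMeasure : ∀ t, 0 ≤ t → IsProbabilityMeasure (ϱ t)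
  finiteEnergy : ∀ᵐ t ∂(volume.restrict (Ioi (0 : ℝ))), MemLp (v t) 2 (ϱ t)
  /-- The pairings of `ϱ`, `ϱv` and `ϱv²` with test functions are well defined. -/
  pairing : ∀ φ, IsTestFunction φ → ∀ k : ℕ, k ≤ 2 →
    IntegrableOn (fun t => ∫ x, φ (t, x) * v t x ^ k ∂(ϱ t)) (Ioi 0)
  continuityEquation : ∀ φ, IsTestFunction φ →
    -∫ x, φ (0, x) ∂ϱ₀ = ∫ t in Ioi (0 : ℝ), ∫ x, (dt φ t x + v t x * dx φ t x) ∂(ϱ t)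
  momentumEquation : ∀ ζ, IsTestFunction ζ →
    -∫ x, ζ (0, x) * v₀ x ∂ϱ₀ =
      ∫ t in Ioi (0 : ℝ), ∫ x, (dt ζ t x + v t x * dx ζ t x) * v t x ∂(ϱ t)

end PGD

end

/-! The cone of monotone maps is closed and convex, because its elements are exactly the maps that
are nondecreasing off a null set (`mem_monotoneCone_iff`). Projection onto it is therefore
nonexpansive, so `t ↦ X_t` is Lipschitz with constant `‖V̄‖`, and Rademacher's theorem in the
separable Hilbert space `L²(μ)` (`ae_differentiableAt_of_lipschitzWith`) gives a velocity `V_t` for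
a.e. `t`.

Two facts about the cone do the rest. Difference quotients from the right and from the left put both
`V_t` and `-V_t` in the tangent cone at `X_t`; both are monotone on level sets of `X_t`, so `V_t` is
constant there and equals `v_t ∘ X_t` (`exists_memLp_comp_of_hasDerivAt`). Also, `X_t ± c φ(X_t)` is
still monotone for small `c`, so `X̄ + tV̄ - X_t` is orthogonal to `H_{X_t}` for every `t`
(`inner_eq_zero_of_isMetricProj`). Differentiating this orthogonality against `φ(t, X_t)` yields `V̄
- V_t ⟂ H_{X_t}` (`deriv_eq_starProjection`).

The weak equations come from integrating the time derivative of `φ(t, X_t)` paired with the constant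
`1` (mass) and with `V̄` (momentum). In the second pairing `V̄` may be replaced by its projection
`V_t`, since the derivative of `φ(t, X_t)` lies in `H_{X_t}`; this produces the flux `ϱv²`. -/

noncomputable section

namespace PGD

open Filter Topology NNReal InnerProductSpace

/-! ### Differentiability of Lipschitz curves in a separable Hilbert space. -/

section HilbertRademacher

variable {H : Type*} [NormedAddCommGroup H] [InnerProductSpace ℝ H]

theorem eq_of_lipschitzWith_of_ae_hasDerivAt_zero {f : ℝ → H} {K : ℝ≥0}
    (hf : LipschitzWith K f) (h : ∀ᵐ t, HasDerivAt f 0 t) (a b : ℝ) : f a = f b := by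
  obtain ⟨C, hC⟩ := (hf.lipschitzOnWith (s :=
      uIcc a b)).absolutelyContinuousOnInterval.const_of_ae_hasDerivAt_zero
    (h.mono fun t ht _ => ht)
  rw [hC a left_mem_uIcc, hC b right_mem_uIcc]

theorem lipschitzWith_integral {w : ℝ → H} {K : ℝ≥0}
    (hw : LocallyIntegrable w) (hK : ∀ᵐ t, ‖w t‖ ≤ K) :
    LipschitzWith K fun x => ∫ t in (0 : ℝ)..x, w t := by
  have hi (x y : ℝ) : IntervalIntegrable w volume x y :=
    intervalIntegrable_iff.mpr <|
      (hw.integrableOn_isCompact isCompact_uIcc).mono_set uIoc_subset_uIcc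
  refine LipschitzWith.of_dist_le_mul fun x y => ?_
  rw [dist_eq_norm, intervalIntegral.integral_interval_sub_left (hi _ _) (hi _ _), Real.dist_eq]
  exact intervalIntegral.norm_integral_le_of_norm_le_const_ae (hK.mono fun t ht _ => ht)

/-- Orthonormal vectors lie at mutual distance `√2`, so the balls of radius `1/2` around them are
disjoint. -/
theorem countable_of_orthonormal [SecondCountableTopology H] {ι : Type*} {b : ι → H}
    (hb : Orthonormal ℝ b) : Countable ι := by
  refine Pairwise.countable_of_isOpen_disjoint (s := fun i => Metric.ball (b i) (1 / 2)) ?_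
    (fun i => Metric.isOpen_ball) (fun i => ⟨b i, Metric.mem_ball_self (by norm_num)⟩)
  intro i j hij
  refine Metric.ball_disjoint_ball ?_
  have h : ‖b i - b j‖ ^ 2 = 2 := by
    rw [norm_sub_sq_real, hb.1 i, hb.1 j, hb.2 hij]; norm_num
  rw [dist_eq_norm]
  nlinarith [norm_nonneg (b i - b j)]

/-- A Lipschitz curve in a separable Hilbert space has a weak derivative, which is an honest
measurable function. -/
theorem exists_weakDeriv {X : ℝ → H} {K : ℝ≥0} (hX : LipschitzWith K X) {ι : Type*} [Countable ι]
    (b : HilbertBasis ι ℝ H) :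
    ∃ w : ℝ → H, StronglyMeasurable w ∧ (∀ᵐ t, ‖w t‖ ≤ K) ∧
      ∀ᵐ t, ∀ i, HasDerivAt (fun s => inner ℝ (b i) (X s)) (inner ℝ (b i) (w t)) t := by
  have hlip (i : ι) : LipschitzWith K fun s => inner ℝ (b i) (X s) := by
    refine LipschitzWith.of_dist_le_mul fun x y => ?_
    rw [Real.dist_eq, ← inner_sub_right]
    refine (abs_real_inner_le_norm _ _).trans ?_
    rw [b.orthonormal.1 i, one_mul, ← dist_eq_norm]
    exact hX.dist_le_mul x y
  have hdiff : ∀ᵐ t, ∀ i, DifferentiableAt ℝ (fun s => inner ℝ (b i) (X s)) t :=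
    ae_all_iff.2 fun i => (hlip i).ae_differentiableAt_real
  let a (i : ι) (t : ℝ) : ℝ := deriv (fun s => inner ℝ (b i) (X s)) t
  let S (s : Finset ι) (t : ℝ) : H := ∑ i ∈ s, a i t • b i
  -- By Bessel's inequality, finite partial sums of the expansion of `X` inherit the Lipschitz
  -- constant `K`. Their derivatives are thus bounded by `K` uniformly in `s`, which makes the
  -- coordinate derivatives square summable.
  have hSlip (s : Finset ι) : LipschitzWith K fun t => ∑ i ∈ s, inner ℝ (b i) (X t) • b i := by
    refine LipschitzWith.of_dist_le_mul fun x y => ?_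
    rw [dist_eq_norm, ← Finset.sum_sub_distrib]
    simp_rw [← sub_smul, ← inner_sub_right]
    refine le_trans ?_ ((dist_eq_norm (X x) (X y)).symm.le.trans (hX.dist_le_mul x y))
    refine le_of_sq_le_sq ?_ (norm_nonneg _)
    rw [← real_inner_self_eq_norm_sq, b.orthonormal.inner_sum]
    refine le_trans (le_of_eq ?_) (b.orthonormal.sum_inner_products_le (X x - X y) (s := s))
    exact Finset.sum_congr rfl fun i _ => by simp [sq]
  have hSder : ∀ᵐ t, ∀ s : Finset ι, ‖S s t‖ ≤ K := by
    filter_upwards [hdiff] with t ht s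
    have : HasDerivAt (fun t => ∑ i ∈ s, inner ℝ (b i) (X t) • b i) (S s t) t :=
      HasDerivAt.fun_sum fun i _ => (ht i).hasDerivAt.smul_const (b i)
    exact this.le_of_lipschitz (hSlip s)
  have hmem : ∀ᵐ t, Memℓp (fun i => a i t) 2 := by
    filter_upwards [hSder] with t ht
    refine memℓp_gen' (C := (K : ℝ) ^ 2) fun s => ?_
    have h1 : ‖S s t‖ ^ 2 = ∑ i ∈ s, a i t * a i t := by
      rw [← real_inner_self_eq_norm_sq, b.orthonormal.inner_sum]
      simp
    have h2 : ‖S s t‖ ^ 2 ≤ (K : ℝ) ^ 2 := pow_le_pow_left₀ (norm_nonneg _) (ht s) 2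
    rw [h1] at h2
    refine le_trans (le_of_eq (Finset.sum_congr rfl fun i _ => ?_)) h2
    simp [sq]
  have hlim : ∀ᵐ t, ∃ l, Tendsto (fun s => S s t) atTop (𝓝 l) ∧ ∀ i, inner ℝ (b i) l = a i t := by
    filter_upwards [hmem] with t ht
    refine ⟨b.repr.symm ⟨_, ht⟩, b.hasSum_repr_symm ⟨_, ht⟩, fun i => ?_⟩
    rw [← b.repr_apply_apply, LinearIsometryEquiv.apply_symm_apply]
  have hSm (s : Finset ι) : StronglyMeasurable (S s) :=
    Finset.stronglyMeasurable_fun_sum _ fun i _ =>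
      ((measurable_deriv _).stronglyMeasurable).smul_const _
  -- As `ι` is countable, a sequence of finite sets exhausts it; a limit along a sequence of
  -- measurable functions is measurable.
  obtain ⟨σ, hσ⟩ := (atTop : Filter (Finset ι)).exists_seq_tendsto
  obtain ⟨w, hw, hwl⟩ := exists_stronglyMeasurable_limit_of_tendsto_ae
    (fun n => (hSm (σ n)).aestronglyMeasurable (μ := volume))
    (hlim.mono fun t ⟨l, hl, _⟩ => ⟨l, hl.comp hσ⟩)
  refine ⟨w, hw, ?_, ?_⟩
  · filter_upwards [hwl, hSder] with t h1 h2
    exact le_of_tendsto h1.norm (Eventually.of_forall fun n => h2 (σ n))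
  · filter_upwards [hwl, hlim, hdiff] with t h1 ⟨l, h2, h3⟩ h4 i
    rw [tendsto_nhds_unique h1 (h2.comp hσ), h3 i]
    exact (h4 i).hasDerivAt

/-- **Rademacher's theorem** for Lipschitz curves in a separable Hilbert space. -/
theorem ae_differentiableAt_of_lipschitzWith [CompleteSpace H] [SecondCountableTopology H]
    {X : ℝ → H} {K : ℝ≥0} (hX : LipschitzWith K X) :
    ∀ᵐ t, DifferentiableAt ℝ X t := by
  obtain ⟨ι, b, -⟩ := exists_hilbertBasis ℝ H
  have : Countable ι := countable_of_orthonormal b.orthonormal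
  obtain ⟨w, hwm, hwK, hw⟩ := exists_weakDeriv hX b
  have hwi : LocallyIntegrable w :=
    (locallyIntegrable_const (K : ℝ)).mono hwm.aestronglyMeasurable
      (hwK.mono fun t ht => by simpa using ht)
  have hZ := lipschitzWith_integral hwi hwK
  have hZd := LocallyIntegrable.ae_hasDerivAt_integral hwi
  -- The coordinates of both sides have the same derivative a.e. Once `X` is a Bochner integral,
  -- Lebesgue differentiation turns the weak derivative into a strong one.
  have key : ∀ t, X t = X 0 + ∫ s in (0 : ℝ)..t, w s := by
    intro t
    refine b.repr.injective (lp.ext (funext fun i => ?_))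
    rw [b.repr_apply_apply, b.repr_apply_apply]
    have h0 := eq_of_lipschitzWith_of_ae_hasDerivAt_zero (K := ‖innerSL ℝ (b i)‖₊ * (K + K))
      (f := fun t => inner ℝ (b i) (X t - ∫ s in (0 : ℝ)..t, w s)) ?_ ?_ t 0
    · simp only [intervalIntegral.integral_same, sub_zero, inner_sub_right] at h0
      rw [inner_add_right]; linarith
    · exact (innerSL ℝ (b i)).lipschitz.comp (hX.sub hZ)
    · filter_upwards [hw, hZd] with t h1 h2
      have := (h1 i).sub ((innerSL ℝ (b i)).hasFDerivAt.comp_hasDerivAt t (h2 0))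
      simpa [inner_sub_right, Function.comp_def] using! this
  filter_upwards [hZd] with t ht
  have : X = fun t => X 0 + ∫ s in (0 : ℝ)..t, w s := funext key
  rw [this]
  exact ((ht 0).const_add _).differentiableAt

end HilbertRademacher

/-! ### The cone of monotone maps: closedness, convexity, uniqueness of transport. -/

section Cone

variable {μ : Measure ℝ}

theorem measurable_coeFn (X : Lp ℝ 2 μ) : Measurable X := (Lp.stronglyMeasurable X).measurable

theorem exists_subseq_ae_tendsto {f : ℕ → Lp ℝ 2 μ} {g : Lp ℝ 2 μ}
    (h : Tendsto f atTop (𝓝 g)) :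
    ∃ σ : ℕ → ℕ, StrictMono σ ∧ ∀ᵐ m ∂μ, Tendsto (fun n => f (σ n) m) atTop (𝓝 (g m)) :=
  (tendstoInMeasure_of_tendsto_Lp h).exists_seq_tendsto_ae

/-- The support has full measure, so a.e. graph point lies in it. Conversely, a violation of
monotonicity is an open condition on pairs, and every neighbourhood of a support point contains
graph points over `G`; a violation in the support would thus give one in the graph over `G`. -/
theorem mem_monotoneCone_iff {X : Lp ℝ 2 μ} :
    X ∈ monotoneCone μ ↔ ∃ G ∈ ae μ, MonotoneOn X G := by
  have hm : Measurable fun m => (m, X m) := measurable_id.prodMk (measurable_coeFn X)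
  constructor
  · intro h
    refine ⟨_, mem_ae_of_mem_ae_map hm.aemeasurable
      (Measure.support_mem_ae (μ := transportPlan μ X)), ?_⟩
    intro a ha b hb hab
    rcases hab.eq_or_lt with rfl | hlt
    · exact le_rfl
    · have := h _ ha _ hb
      simp only at this
      nlinarith
  · rintro ⟨G, hG, hmono⟩ p hp q hq
    by_contra! hneg
    have hopen : IsOpen {z : (ℝ × ℝ) × (ℝ × ℝ) | (z.1.1 - z.2.1) * (z.1.2 - z.2.2) < 0} :=
      isOpen_lt (by fun_prop) continuous_const
    obtain ⟨u, v, hu, hv, hpu, hqv, huv⟩ := isOpen_prod_iff.1 hopen p q hneg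
    have key : ∀ r ∈ (transportPlan μ X).support, ∀ w : Set (ℝ × ℝ), IsOpen w → r ∈ w →
        ∃ m ∈ G, (m, X m) ∈ w := by
      intro r hr w hw hrw
      have h0 := (Measure.mem_support_iff_forall r).1 hr w (hw.mem_nhds hrw)
      rw [transportPlan, Measure.map_apply hm hw.measurableSet] at h0
      have h1 : ∃ᶠ m in ae μ, (m, X m) ∈ w := frequently_ae_iff.2 h0.ne'
      obtain ⟨m, h2, h3⟩ := (h1.and_eventually hG).exists
      exact ⟨m, h3, h2⟩
    obtain ⟨a, ha, hau⟩ := key p hp u hu hpu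
    obtain ⟨b, hb, hbv⟩ := key q hq v hv hqv
    have h1 : (a - b) * (X a - X b) < 0 := huv (mk_mem_prod hau hbv)
    rcases le_total a b with hab | hab
    · nlinarith [hmono ha hb hab]
    · nlinarith [hmono hb ha hab]

theorem mem_monotoneCone_of_ae_eq {X : Lp ℝ 2 μ} {f : ℝ → ℝ} (h : X =ᵐ[μ] f) {G : Set ℝ}
    (hG : G ∈ ae μ) (hf : MonotoneOn f G) : X ∈ monotoneCone μ := by
  refine mem_monotoneCone_iff.2 ⟨_, inter_mem hG h, ?_⟩
  intro a ha b hb hab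
  have h1 : X a = f a := ha.2
  have h2 : X b = f b := hb.2
  rw [h1, h2]
  exact hf ha.1 hb.1 hab

theorem isClosed_monotoneCone : IsClosed (monotoneCone μ) := by
  refine IsSeqClosed.isClosed fun f g hf hfg => ?_
  obtain ⟨σ, -, hσ⟩ := exists_subseq_ae_tendsto hfg
  choose G hG hmono using fun n => mem_monotoneCone_iff.1 (hf (σ n))
  refine mem_monotoneCone_iff.2 ⟨_, inter_mem (countable_iInter_mem.2 hG) hσ, ?_⟩
  intro a ha b hb hab
  exact le_of_tendsto_of_tendsto' ha.2 hb.2 fun n =>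
    hmono n (mem_iInter.1 ha.1 n) (mem_iInter.1 hb.1 n) hab

theorem zero_mem_monotoneCone : (0 : Lp ℝ 2 μ) ∈ monotoneCone μ :=
  mem_monotoneCone_of_ae_eq (Lp.coeFn_zero ℝ 2 μ) univ_mem fun _ _ _ _ _ => le_rfl

theorem add_mem_monotoneCone {X Y : Lp ℝ 2 μ} (hX : X ∈ monotoneCone μ)
    (hY : Y ∈ monotoneCone μ) : X + Y ∈ monotoneCone μ := by
  obtain ⟨G, hG, h⟩ := mem_monotoneCone_iff.1 hX
  obtain ⟨G', hG', h'⟩ := mem_monotoneCone_iff.1 hY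
  exact mem_monotoneCone_of_ae_eq (Lp.coeFn_add X Y) (inter_mem hG hG')
    ((h.mono inter_subset_left).add (h'.mono inter_subset_right))

theorem smul_mem_monotoneCone {X : Lp ℝ 2 μ} (hX : X ∈ monotoneCone μ) {c : ℝ} (hc : 0 ≤ c) :
    c • X ∈ monotoneCone μ := by
  obtain ⟨G, hG, h⟩ := mem_monotoneCone_iff.1 hX
  exact mem_monotoneCone_of_ae_eq (Lp.coeFn_smul c X) hG
    fun a ha b hb hab => mul_le_mul_of_nonneg_left (h ha hb hab) hc

theorem convex_monotoneCone : Convex ℝ (monotoneCone μ) :=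
  fun _ hX _ hY _ _ ha hb _ =>
    add_mem_monotoneCone (smul_mem_monotoneCone hX ha) (smul_mem_monotoneCone hY hb)

/-- A monotone map is determined by the measure onto which it transports `μ`. -/
theorem eq_of_mem_monotoneCone_of_map_eq [IsFiniteMeasure μ] {X Y : Lp ℝ 2 μ}
    (hX : X ∈ monotoneCone μ) (hY : Y ∈ monotoneCone μ) (h : μ.map X = μ.map Y) : X = Y := by
  obtain ⟨G, hG, hXm⟩ := mem_monotoneCone_iff.1 hX
  obtain ⟨G', hG', hYm⟩ := mem_monotoneCone_iff.1 hY
  have hq : ∀ q : ℚ, ∀ᵐ m ∂μ, (X m ≤ q ↔ Y m ≤ q) := by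
    intro q
    have hA : MeasurableSet (X ⁻¹' Iic (q : ℝ)) := measurable_coeFn X measurableSet_Iic
    have hB : MeasurableSet (Y ⁻¹' Iic (q : ℝ)) := measurable_coeFn Y measurableSet_Iic
    have hAB : μ (X ⁻¹' Iic (q : ℝ)) = μ (Y ⁻¹' Iic (q : ℝ)) := by
      rw [← Measure.map_apply (measurable_coeFn X) measurableSet_Iic, h,
        Measure.map_apply (measurable_coeFn Y) measurableSet_Iic]
    -- Up to null sets both sublevel sets are initial segments of the line, hence nested one way or
    -- the other; having equal finite measure, they agree a.e.
    by_cases hsub : ∀ m ∈ G ∩ G', X m ≤ q → Y m ≤ q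
    · have h1 : X ⁻¹' Iic (q : ℝ) ≤ᵐ[μ] Y ⁻¹' Iic (q : ℝ) := by
        filter_upwards [inter_mem hG hG'] with m hm using hsub m hm
      exact (ae_eq_of_ae_subset_of_measure_ge h1 hAB.ge hA.nullMeasurableSet
        (measure_ne_top μ _)).mono fun m hm => iff_of_eq hm
    · push Not at hsub
      obtain ⟨a, ha, haX, haY⟩ := hsub
      have h1 : Y ⁻¹' Iic (q : ℝ) ≤ᵐ[μ] X ⁻¹' Iic (q : ℝ) := by
        filter_upwards [inter_mem hG hG'] with m hm hmY
        have hma : m ≤ a := by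
          by_contra! hlt
          exact absurd (hmY : Y m ≤ q) (not_le.2 (haY.trans_le (hYm ha.2 hm.2 hlt.le)))
        exact (hXm hm.1 ha.1 hma).trans haX
      exact (ae_eq_of_ae_subset_of_measure_ge h1 hAB.le hB.nullMeasurableSet
        (measure_ne_top μ _)).mono fun m hm => (iff_of_eq hm).symm
  refine Lp.ext ?_
  filter_upwards [ae_all_iff.2 hq] with m hm
  refine le_antisymm ?_ ?_
  · exact le_of_forall_lt_rat_imp_le fun q hq' => (hm q).2 hq'.le
  · exact le_of_forall_lt_rat_imp_le fun q hq' => (hm q).1 hq'.le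

end Cone

/-! ### Metric projections onto convex sets. -/

section Projection

variable {H : Type*} [NormedAddCommGroup H] {C : Set H}

theorem isMetricProj_self {Y : H} (hY : Y ∈ C) : IsMetricProj C Y Y := by
  refine ⟨hY, ?_⟩
  have : Nonempty C := ⟨⟨Y, hY⟩⟩
  rw [sub_self, norm_zero]
  refine le_antisymm (Real.iInf_nonneg fun _ => norm_nonneg _) ?_
  refine (ciInf_le ⟨0, forall_mem_range.2 fun _ => norm_nonneg _⟩ ⟨Y, hY⟩).trans ?_
  simp

variable [InnerProductSpace ℝ H]

theorem isMetricProj_iff (hC : Convex ℝ C) {Y Z : H} :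
    IsMetricProj C Y Z ↔ Z ∈ C ∧ ∀ W ∈ C, inner ℝ (Y - Z) (W - Z) ≤ 0 :=
  and_congr_right fun hZ => norm_eq_iInf_iff_real_inner_le_zero hC hZ

/-- Add the two variational inequalities, each tested with the other projection, and apply
Cauchy–Schwarz. -/
theorem IsMetricProj.norm_sub_le (hC : Convex ℝ C) {Y Z Y' Z' : H} (h : IsMetricProj C Y Z)
    (h' : IsMetricProj C Y' Z') : ‖Z - Z'‖ ≤ ‖Y - Y'‖ := by
  obtain ⟨hZ, h⟩ := (isMetricProj_iff hC).1 h
  obtain ⟨hZ', h'⟩ := (isMetricProj_iff hC).1 h'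
  have h1 := h Z' hZ'
  have h2 := h' Z hZ
  have h3 : inner ℝ (Z - Z') (Z - Z') ≤ inner ℝ (Y - Y') (Z - Z') := by
    have e : inner ℝ (Y - Y') (Z - Z') - inner ℝ (Z - Z') (Z - Z') =
        -(inner ℝ (Y - Z) (Z' - Z) + inner ℝ (Y' - Z') (Z - Z')) := by
      simp only [inner_sub_left, inner_sub_right]; ring
    linarith
  rw [real_inner_self_eq_norm_sq] at h3
  have h4 := h3.trans (real_inner_le_norm _ _)
  rcases (norm_nonneg (Z - Z')).eq_or_lt with h5 | h5
  · rw [← h5]; exact norm_nonneg _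
  · nlinarith

theorem exists_isMetricProj [CompleteSpace H] (hC : Convex ℝ C) (hcl : IsClosed C)
    (hne : C.Nonempty) (Y : H) : ∃ Z, ∀ Z', IsMetricProj C Y Z' ↔ Z' = Z := by
  obtain ⟨Z, hZ, h⟩ := exists_norm_eq_iInf_of_complete_convex hne hcl.isComplete hC Y
  refine ⟨Z, fun Z' => ⟨fun h' => ?_, ?_⟩⟩
  · have := IsMetricProj.norm_sub_le hC h' ⟨hZ, h⟩
    simpa [sub_eq_zero] using this
  · rintro rfl
    exact ⟨hZ, h⟩

end Projection

/-! ### Velocities as functions of the position. -/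

section LevelSets

variable {μ : Measure ℝ}

/-- A function that is constant on the level sets of `X`, outside of a null set, is a measurable
function of `X`. -/
theorem exists_measurable_comp_of_const_on_levelSets {X W : ℝ → ℝ} (hX : Measurable X)
    (hW : Measurable W) {G : Set ℝ} (hG : G ∈ ae μ)
    (h : ∀ a ∈ G, ∀ b ∈ G, X a = X b → W a = W b) :
    ∃ v : ℝ → ℝ, Measurable v ∧ W =ᵐ[μ] v ∘ X := by
  obtain ⟨T, hTG, hT, hTμ⟩ := exists_measurable_superset_of_null (mem_ae_iff.1 hG)
  have hA : MeasurableSet Tᶜ := hT.compl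
  have hAG : ∀ a : (Tᶜ : Set ℝ), (a : ℝ) ∈ G := fun a => by
    by_contra ha; exact a.2 (hTG ha)
  have := hA.standardBorel
  let f : (Tᶜ : Set ℝ) → ℝ := fun a => X a
  have hf : Measurable f := hX.comp measurable_subtype_coe
  have hfac : Function.FactorsThrough (fun a : (Tᶜ : Set ℝ) => W a) f :=
    fun a b hab => h a (hAG a) b (hAG b) hab
  obtain ⟨g, hg⟩ : ∃ g : ℝ → ℝ, (fun a : (Tᶜ : Set ℝ) => W a) = g ∘ f :=
    (Function.factorsThrough_iff _).1 hfac
  have hgm : Measurable (g ∘ f) := hg ▸ hW.comp measurable_subtype_coe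
  -- Measurability descends from `g ∘ f` to `g` on `range f` because the domain is standard Borel;
  -- this is why `G` was shrunk to a Borel set. The range need not be Borel, so `g` is then extended
  -- from it to a measurable `v`.
  have hgr : Measurable (domRestrict (range f) g) := hf.measurable_comp_iff_restrict.1 hgm
  obtain ⟨v, hv, hgv⟩ := Measurable.exists_eq_measurable_comp (f := ((↑) : range f → ℝ)) hgr
  refine ⟨v, hv, ?_⟩
  filter_upwards [compl_mem_ae_iff.2 hTμ] with m hm
  have h1 : W m = g (f ⟨m, hm⟩) := congrFun hg ⟨m, hm⟩
  have h2 : g (f ⟨m, hm⟩) = v (f ⟨m, hm⟩) := congrFun hgv ⟨f ⟨m, hm⟩, mem_range_self _⟩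
  exact h1.trans h2

/-- Elements of the tangent cone of the monotone maps at `X` are monotone on the level sets
of `X`. -/
theorem monotone_on_levelSets_of_tendsto {X V : Lp ℝ 2 μ}
    {Z : ℕ → Lp ℝ 2 μ} (hZ : ∀ n, Z n ∈ monotoneCone μ) {c : ℕ → ℝ} (hc : ∀ n, 0 ≤ c n)
    (h : Tendsto (fun n => c n • (Z n - X)) atTop (𝓝 V)) :
    ∃ G ∈ ae μ, ∀ a ∈ G, ∀ b ∈ G, a ≤ b → X a = X b → V a ≤ V b := by
  obtain ⟨σ, -, hσ⟩ := exists_subseq_ae_tendsto h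
  choose G hG hmono using fun n => mem_monotoneCone_iff.1 (hZ (σ n))
  have he : ∀ᵐ m ∂μ, ∀ n, (c n • (Z n - X)) m = c n * (Z n m - X m) := by
    refine ae_all_iff.2 fun n => ?_
    filter_upwards [Lp.coeFn_smul (c n) (Z n - X), Lp.coeFn_sub (Z n) X] with m h1 h2
    rw [h1, Pi.smul_apply, h2, Pi.sub_apply, smul_eq_mul]
  refine ⟨_, inter_mem (inter_mem (countable_iInter_mem.2 hG) hσ) he, ?_⟩
  rintro a ⟨⟨ha, hta⟩, hea⟩ b ⟨⟨hb, htb⟩, heb⟩ hab hXab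
  refine le_of_tendsto_of_tendsto' hta htb fun n => ?_
  -- On a level set the subtracted values of `X` coincide, so the quotients are ordered as the
  -- values of `Z n`.
  rw [hea, heb, hXab]
  exact mul_le_mul_of_nonneg_left
    (sub_le_sub_right (hmono n (mem_iInter.1 ha n) (mem_iInter.1 hb n) hab) _) (hc _)

/-- The velocity of a curve of monotone maps is constant on the level sets. -/
theorem const_on_levelSets_of_hasDerivAt {X : ℝ → Lp ℝ 2 μ} (hX : ∀ t, X t ∈ monotoneCone μ)
    {V : Lp ℝ 2 μ} {t : ℝ} (hV : HasDerivAt X V t) :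
    ∃ G ∈ ae μ, ∀ a ∈ G, ∀ b ∈ G, X t a = X t b → V a = V b := by
  have hlim : Tendsto (fun n : ℕ => (1 / ((n : ℝ) + 1))) atTop (𝓝 0) :=
    tendsto_one_div_add_atTop_nhds_zero_nat
  have hpos (n : ℕ) : (0 : ℝ) < n + 1 := by positivity
  have h1 : Tendsto (fun n : ℕ => ((n : ℝ) + 1) • (X (t + 1 / ((n : ℝ) + 1)) - X t)) atTop
      (𝓝 V) := by
    have := (hasDerivAt_iff_tendsto_slope_zero.1 hV).comp
      (tendsto_nhdsWithin_iff.2 ⟨hlim, Eventually.of_forall fun n => (one_div_pos.2 (hpos n)).ne'⟩)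
    simpa [Function.comp_def] using! this
  -- The left difference quotients, with sign reversed, are again nonnegative multiples of (monotone
  -- map minus `X t`), so `-V` is monotone on level sets too.
  have h2 : Tendsto (fun n : ℕ => ((n : ℝ) + 1) • (X (t + -(1 / ((n : ℝ) + 1))) - X t)) atTop
      (𝓝 (-V)) := by
    have := ((hasDerivAt_iff_tendsto_slope_zero.1 hV).comp
      (tendsto_nhdsWithin_iff.2 ⟨by simpa using hlim.neg, Eventually.of_forall
        fun n => (neg_lt_zero.2 (one_div_pos.2 (hpos n))).ne⟩)).neg
    refine this.congr fun n => ?_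
    simp only [Function.comp_apply, inv_neg, one_div, inv_inv, neg_smul, neg_neg]
  obtain ⟨G, hG, hm⟩ := monotone_on_levelSets_of_tendsto (fun n => hX _)
    (fun n => (hpos n).le) h1
  obtain ⟨G', hG', hm'⟩ := monotone_on_levelSets_of_tendsto (fun n => hX _)
    (fun n => (hpos n).le) h2
  refine ⟨_, inter_mem (inter_mem hG hG') (Lp.coeFn_neg V), ?_⟩
  have key : ∀ a ∈ G ∩ G' ∩ {m | (-V) m = (-⇑V) m}, ∀ b ∈ G ∩ G' ∩ {m | (-V) m = (-⇑V) m},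
      a ≤ b → X t a = X t b → V a = V b := by
    rintro a ⟨⟨ha, ha'⟩, hna⟩ b ⟨⟨hb, hb'⟩, hnb⟩ hab hX
    have h3 := hm' a ha' b hb' hab hX
    rw [show (-V) a = -V a from hna, show (-V) b = -V b from hnb] at h3
    exact le_antisymm (hm a ha b hb hab hX) (neg_le_neg_iff.1 h3)
  intro a ha b hb hX
  rcases le_total a b with hab | hab
  · exact key a ha b hb hab hX
  · exact (key b hb a ha hab hX.symm).symm

end LevelSets

/-! ### The space of functions of the position, and the first-order condition for projections. -/

section ClosedSpan

variable {μ : Measure ℝ}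

/-- Composition with `X` is an isometry from `L²` of the push-forward into `L²(μ)`, and smooth
compactly supported functions are dense in the former. -/
theorem mem_closedSpan_of_ae_eq_comp [IsFiniteMeasure μ] {X W : Lp ℝ 2 μ} {v : ℝ → ℝ}
    (hv : MemLp v 2 (μ.map X))
    (hW : W =ᵐ[μ] v ∘ X) : W ∈ closedSpan X := by
  have hX := measurable_coeFn X
  have hfin : IsFiniteMeasure (μ.map X) := Measure.isFiniteMeasure_map μ X
  refine Metric.mem_closure_iff.2 fun ε hε => ?_
  obtain ⟨g, hgc, hgs, hg⟩ := hv.exist_eLpNorm_sub_le (by simp) (by simp) (half_pos hε)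
  have hgm : MemLp g 2 (μ.map X) := hgs.continuous.memLp_of_hasCompactSupport hgc
  have hgX : MemLp (g ∘ X) 2 μ := hgm.comp_of_map hX.aemeasurable
  refine ⟨hgX.toLp, ⟨g, hgs, hgc, hgX.coeFn_toLp⟩, ?_⟩
  rw [Lp.dist_def]
  have h1 : eLpNorm (⇑W - ⇑(hgX.toLp)) 2 μ = eLpNorm (v - g) 2 (μ.map X) := by
    rw [eLpNorm_map_measure (hv.aestronglyMeasurable.sub hgm.aestronglyMeasurable) hX.aemeasurable]
    refine eLpNorm_congr_ae ?_
    filter_upwards [hW, hgX.coeFn_toLp] with m h1 h2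
    simp only [Pi.sub_apply, Function.comp_apply, h1, h2]
  rw [h1]
  refine (ENNReal.toReal_le_of_le_ofReal (half_pos hε).le hg).trans_lt (half_lt_self hε)

/-- Adding a small multiple of `φ ∘ X`, with `φ` Lipschitz, to a monotone map `X` preserves
monotonicity. -/
theorem add_smul_mem_monotoneCone {X W : Lp ℝ 2 μ} (hX : X ∈ monotoneCone μ) {φ : ℝ → ℝ}
    {K : ℝ≥0} (hφ : LipschitzWith K φ) (hW : W =ᵐ[μ] fun m => φ (X m)) {c : ℝ}
    (hc : |c| * K ≤ 1) : X + c • W ∈ monotoneCone μ := by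
  obtain ⟨G, hG, h⟩ := mem_monotoneCone_iff.1 hX
  refine mem_monotoneCone_of_ae_eq (f := fun m => X m + c * φ (X m)) ?_ hG ?_
  · filter_upwards [Lp.coeFn_add X (c • W), Lp.coeFn_smul c W, hW] with m h1 h2 h3
    rw [h1, Pi.add_apply, h2, Pi.smul_apply, h3, smul_eq_mul]
  · intro a ha b hb hab
    have h1 := h ha hb hab
    have h2 : |c * (φ (X a) - φ (X b))| ≤ X b - X a := by
      have h4 := hφ.dist_le_mul (X a) (X b)
      rw [Real.dist_eq, Real.dist_eq, abs_sub_comm (X a), abs_of_nonneg (sub_nonneg.2 h1)] at h4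
      rw [abs_mul]
      calc |c| * |φ (X a) - φ (X b)| ≤ |c| * (K * (X b - X a)) := by gcongr
        _ = |c| * K * (X b - X a) := by ring
        _ ≤ 1 * (X b - X a) := mul_le_mul_of_nonneg_right hc (sub_nonneg.2 h1)
        _ = _ := one_mul _
    have h3 := (le_abs_self _).trans h2
    change X a + c * φ (X a) ≤ X b + c * φ (X b)
    linarith

/-- Both `X + c φ(X)` and `X - c φ(X)` are admissible competitors, so the variational inequality
holds with either sign. -/
theorem inner_eq_zero_of_isMetricProj {X Y W : Lp ℝ 2 μ} (h : IsMetricProj (monotoneCone μ) Y X)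
    (hW : W ∈ closedSpan X) : inner ℝ (Y - X) W = 0 := by
  obtain ⟨hX, h⟩ := (isMetricProj_iff convex_monotoneCone).1 h
  have hle : closedSpan X ≤ (ℝ ∙ (Y - X))ᗮ := by
    refine Submodule.topologicalClosure_minimal _ ?_ (Submodule.isClosed_orthogonal _)
    rintro W ⟨φ, hφ, hφc, hW⟩
    rw [Submodule.mem_orthogonal_singleton_iff_inner_right]
    obtain ⟨K, hK⟩ := ContDiff.lipschitzWith_of_hasCompactSupport hφc hφ (by simp)
    -- The `+ 1` keeps `c` well defined and positive when `K = 0`, while still `c K ≤ 1`.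
    have hc : (0 : ℝ) < 1 / (K + 1) := by positivity
    have hcK : (1 / ((K : ℝ) + 1)) * K ≤ 1 := by
      rw [one_div_mul_eq_div, div_le_one (by positivity)]; linarith
    have h1 := h _ (add_smul_mem_monotoneCone hX hK hW (c := 1 / (K + 1))
      (by rwa [abs_of_pos hc]))
    have h2 := h _ (add_smul_mem_monotoneCone hX hK hW (c := -(1 / (K + 1)))
      (by rwa [abs_neg, abs_of_pos hc]))
    rw [add_sub_cancel_left, real_inner_smul_right] at h1 h2
    nlinarith
  exact (Submodule.mem_orthogonal_singleton_iff_inner_right).1 (hle hW)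

/-- The velocity of a curve of monotone maps is a function of the position. -/
theorem exists_memLp_comp_of_hasDerivAt {X : ℝ → Lp ℝ 2 μ} (hX : ∀ t, X t ∈ monotoneCone μ)
    {V : Lp ℝ 2 μ} {t : ℝ} (hV : HasDerivAt X V t) :
    ∃ v : ℝ → ℝ, MemLp v 2 (μ.map (X t)) ∧ V =ᵐ[μ] v ∘ X t := by
  obtain ⟨G, hG, h⟩ := const_on_levelSets_of_hasDerivAt hX hV
  obtain ⟨v, hv, hVv⟩ :=
    exists_measurable_comp_of_const_on_levelSets (measurable_coeFn (X t)) (measurable_coeFn V) hG h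
  refine ⟨v, ?_, hVv⟩
  rw [memLp_map_measure_iff hv.aestronglyMeasurable (measurable_coeFn _).aemeasurable]
  exact (memLp_congr_ae hVv).1 (Lp.memLp V)

end ClosedSpan

/-! ### Regularity and bounds for test functions. -/

namespace IsTestFunction

variable {φ : ℝ × ℝ → ℝ}

theorem hasFDerivAt (hφ : IsTestFunction φ) (p : ℝ × ℝ) : HasFDerivAt φ (fderiv ℝ φ p) p :=
  (hφ.1.differentiable (by simp)).differentiableAt.hasFDerivAt

theorem dt_eq (hφ : IsTestFunction φ) (t x : ℝ) : dt φ t x = fderiv ℝ φ (t, x) (1, 0) := by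
  have := (hφ.hasFDerivAt (t, x)).comp_hasDerivAt t
      ((hasDerivAt_id t).prodMk (hasDerivAt_const t x))
  exact this.deriv

theorem dx_eq (hφ : IsTestFunction φ) (t x : ℝ) : dx φ t x = fderiv ℝ φ (t, x) (0, 1) := by
  have := (hφ.hasFDerivAt (t, x)).comp_hasDerivAt x
      ((hasDerivAt_const x t).prodMk (hasDerivAt_id x))
  exact this.deriv

theorem fderiv_apply (hφ : IsTestFunction φ) (e : ℝ × ℝ) : IsTestFunction fun p => fderiv ℝ φ p e :=
  ⟨(hφ.1.fderiv_right (m := ∞) (by simp)).clm_apply contDiff_const, hφ.2.fderiv_apply ℝ e⟩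

theorem timeDeriv (hφ : IsTestFunction φ) : IsTestFunction fun p => dt φ p.1 p.2 := by
  simpa only [hφ.dt_eq] using hφ.fderiv_apply (1, 0)

theorem spaceDeriv (hφ : IsTestFunction φ) : IsTestFunction fun p => dx φ p.1 p.2 := by
  simpa only [hφ.dx_eq] using hφ.fderiv_apply (0, 1)

theorem exists_lipschitz (hφ : IsTestFunction φ) : ∃ K : ℝ≥0, LipschitzWith K φ :=
  ContDiff.lipschitzWith_of_hasCompactSupport hφ.2 hφ.1 (by simp)

theorem exists_bound (hφ : IsTestFunction φ) : ∃ C : ℝ≥0, ∀ p, |φ p| ≤ C := by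
  obtain ⟨C, hC⟩ := hφ.2.exists_bound_of_continuous hφ.1.continuous
  exact ⟨C.toNNReal, fun p => (hC p).trans (Real.le_coe_toNNReal C)⟩

theorem exists_time_bound (hφ : IsTestFunction φ) : ∃ T : ℝ, 0 < T ∧ ∀ t x, T ≤ |t| → φ
    (t, x) = 0 := by
  obtain ⟨R, hR⟩ := hφ.2.isBounded.exists_norm_le
  refine ⟨max R 0 + 1, by positivity, fun t x ht => ?_⟩
  by_contra h
  have h1 := (norm_fst_le (t, x)).trans (hR _ (subset_tsupport _ h))
  rw [Real.norm_eq_abs] at h1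
  linarith [le_max_left R 0]

theorem continuous (hφ : IsTestFunction φ) : Continuous φ := hφ.1.continuous

theorem contDiff_slice (hφ : IsTestFunction φ) (t : ℝ) : ContDiff ℝ ∞ fun x => φ (t, x) :=
  hφ.1.comp (contDiff_const.prodMk contDiff_id)

theorem hasCompactSupport_slice (hφ : IsTestFunction φ) (t : ℝ) : HasCompactSupport fun x => φ
    (t, x) :=
  HasCompactSupport.intro (hφ.2.isCompact.image continuous_snd) fun x hx => by
    by_contra h
    exact hx ⟨(t, x), subset_tsupport _ h, rfl⟩

end IsTestFunction

theorem isTestFunction_mul {χ ψ : ℝ → ℝ} (hχ : ContDiff ℝ ∞ χ) (hχc : HasCompactSupport χ)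
    (hψ : ContDiff ℝ ∞ ψ) (hψc : HasCompactSupport ψ) :
    IsTestFunction fun p => χ p.1 * ψ p.2 := by
  refine ⟨(hχ.comp contDiff_fst).mul (hψ.comp contDiff_snd),
    HasCompactSupport.intro (hχc.isCompact.prod hψc.isCompact) fun p hp => ?_⟩
  by_contra h
  exact hp ⟨subset_tsupport _ (left_ne_zero_of_mul h), subset_tsupport _ (right_ne_zero_of_mul h)⟩

/-! ### Calculus of `φ(t, X)` in `L²`. -/

section Composition

variable {μ : Measure ℝ} {φ : ℝ × ℝ → ℝ}

theorem measurable_comp_coeFn (hφ : IsTestFunction φ) (t : ℝ) (X : Lp ℝ 2 μ) :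
    Measurable fun m => φ (t, X m) :=
  hφ.continuous.measurable.comp (measurable_const.prodMk (measurable_coeFn X))

theorem memLp_comp (hφ : IsTestFunction φ) [IsFiniteMeasure μ] (t : ℝ) (X : Lp ℝ 2 μ) :
    MemLp (fun m => φ (t, X m)) 2 μ := by
  obtain ⟨C, hC⟩ := hφ.exists_bound
  exact MemLp.of_bound (measurable_comp_coeFn hφ t X).aestronglyMeasurable C
    (Eventually.of_forall fun m => hC _)

theorem memLp_comp_mul (hφ : IsTestFunction φ) (t : ℝ) (X W : Lp ℝ 2 μ) :
    MemLp (fun m => φ (t, X m) * W m) 2 μ := by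
  obtain ⟨C, hC⟩ := hφ.exists_bound
  refine MemLp.of_le_mul (c := C) (Lp.memLp W)
    ((measurable_comp_coeFn hφ t X).mul (measurable_coeFn W)).aestronglyMeasurable
    (Eventually.of_forall fun m => ?_)
  rw [norm_mul]
  exact mul_le_mul_of_nonneg_right (hC _) (norm_nonneg _)

/-- `φ (t, X)` as an element of `L²`. -/
def compLp (hφ : IsTestFunction φ) [IsFiniteMeasure μ] (t : ℝ) (X : Lp ℝ 2 μ) : Lp ℝ 2 μ :=
    (memLp_comp hφ t X).toLp _

/-- The product `φ (t, X) W` as an element of `L²`. -/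
def compMulLp (hφ : IsTestFunction φ) (t : ℝ) (X W : Lp ℝ 2 μ) : Lp ℝ 2 μ :=
    (memLp_comp_mul hφ t X W).toLp _

theorem coeFn_compLp (hφ : IsTestFunction φ) [IsFiniteMeasure μ] (t : ℝ) (X : Lp ℝ 2 μ) :
    compLp hφ t X =ᵐ[μ] fun m => φ (t, X m) := MemLp.coeFn_toLp _

theorem coeFn_compMulLp (hφ : IsTestFunction φ) (t : ℝ) (X W : Lp ℝ 2 μ) :
    compMulLp hφ t X W =ᵐ[μ] fun m => φ (t, X m) * W m := MemLp.coeFn_toLp _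

theorem norm_compLp_sub_le (hφ : IsTestFunction φ) [IsProbabilityMeasure μ] {K : ℝ≥0}
    (hK : LipschitzWith K φ)
    (s t : ℝ) (X Y : Lp ℝ 2 μ) :
    ‖compLp hφ s X - compLp hφ t Y‖ ≤ K * |s - t| + K * ‖X - Y‖ := by
  have h1 : ‖compLp hφ s X - compLp hφ t X‖ ≤ K * |s - t| := by
    have := Lp.norm_le_of_ae_bound (f := compLp hφ s X - compLp hφ t X) (C := K * |s - t|)
      (by positivity) ?_
    · simpa [measureUnivNNReal] using this
    · filter_upwards [Lp.coeFn_sub (compLp hφ s X) (compLp hφ t X), coeFn_compLp hφ s X,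
        coeFn_compLp hφ t X] with m h1 h2 h3
      rw [h1, Pi.sub_apply, h2, h3, ← dist_eq_norm]
      refine (hK.dist_le_mul _ _).trans ?_
      simp [Prod.dist_eq, Real.dist_eq]
  have h2 : ‖compLp hφ t X - compLp hφ t Y‖ ≤ K * ‖X - Y‖ := by
    refine Lp.norm_le_mul_norm_of_ae_le_mul ?_
    filter_upwards [Lp.coeFn_sub (compLp hφ t X) (compLp hφ t Y), coeFn_compLp hφ t X,
      coeFn_compLp hφ t Y, Lp.coeFn_sub X Y] with m h1 h2 h3 h4
    rw [h1, Pi.sub_apply, h2, h3, h4, Pi.sub_apply, ← dist_eq_norm, ← dist_eq_norm]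
    refine (hK.dist_le_mul _ _).trans ?_
    simp [Prod.dist_eq]
  have := norm_sub_le_norm_sub_add_norm_sub (compLp hφ s X) (compLp hφ t X) (compLp hφ t Y)
  linarith

theorem norm_compMulLp_sub_le (hφ : IsTestFunction φ) {C : ℝ≥0} (hC : ∀ p, |φ p| ≤ C) (t : ℝ)
    (X W W' : Lp ℝ 2 μ) :
    ‖compMulLp hφ t X W - compMulLp hφ t X W'‖ ≤ C * ‖W - W'‖ := by
  refine Lp.norm_le_mul_norm_of_ae_le_mul ?_
  filter_upwards [Lp.coeFn_sub (compMulLp hφ t X W) (compMulLp hφ t X W'),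
    coeFn_compMulLp hφ t X W, coeFn_compMulLp hφ t X W', Lp.coeFn_sub W W'] with m h1 h2 h3 h4
  rw [h1, Pi.sub_apply, h2, h3, h4, Pi.sub_apply, ← mul_sub, norm_mul]
  exact mul_le_mul_of_nonneg_right (hC _) (norm_nonneg _)

theorem norm_compMulLp_le (hφ : IsTestFunction φ) {C : ℝ≥0} (hC : ∀ p, |φ p| ≤ C) (t : ℝ)
    (X W : Lp ℝ 2 μ) :
    ‖compMulLp hφ t X W‖ ≤ C * ‖W‖ := by
  refine Lp.norm_le_mul_norm_of_ae_le_mul ?_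
  filter_upwards [coeFn_compMulLp hφ t X W] with m h1
  rw [h1, norm_mul]
  exact mul_le_mul_of_nonneg_right (hC _) (norm_nonneg _)

theorem continuous_compLp (hφ : IsTestFunction φ) [IsProbabilityMeasure μ] {X : ℝ → Lp ℝ 2 μ}
    (hX : Continuous X) :
    Continuous fun t => compLp hφ t (X t) := by
  obtain ⟨K, hK⟩ := hφ.exists_lipschitz
  refine continuous_iff_continuousAt.2 fun t => ?_
  refine tendsto_iff_norm_sub_tendsto_zero.2 ?_
  refine squeeze_zero (fun _ => norm_nonneg _) (fun s => norm_compLp_sub_le hφ hK s t _ _) ?_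
  have : Continuous fun s => (K : ℝ) * |s - t| + K * ‖X s - X t‖ := by fun_prop
  simpa using this.tendsto t

/-- Needed for measurability in time when `W` is the velocity. For unbounded `W` the product has no
Lipschitz bound in `X`; but it is Lipschitz in `W` uniformly in `t`, so continuity in `t` need only
be checked for the dense set of bounded continuous `W`. -/
theorem continuous_compMulLp (hφ : IsTestFunction φ) [IsProbabilityMeasure μ]
    {X : ℝ → Lp ℝ 2 μ} (hX : Continuous X) :
    Continuous fun p : Lp ℝ 2 μ × ℝ => compMulLp hφ p.2 (X p.2) p.1 := by
  obtain ⟨C, hC⟩ := hφ.exists_bound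
  refine continuous_prod_of_dense_continuous_lipschitzWith _ C
    (Lp.boundedContinuousFunction_dense ℝ μ (p := 2) (by simp)) (fun W hW => ?_) fun t =>
    LipschitzWith.of_dist_le_mul fun W W' => by
      simpa only [dist_eq_norm] using norm_compMulLp_sub_le hφ hC t (X t) W W'
  obtain ⟨g, hg⟩ := Lp.mem_boundedContinuousFunction_iff.1 hW
  have hgW : W =ᵐ[μ] g := by
    rw [← hg]
    exact ContinuousMap.coeFn_toAEEqFun μ g.toContinuousMap
  refine continuous_iff_continuousAt.2 fun t => tendsto_iff_norm_sub_tendsto_zero.2 ?_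
  refine squeeze_zero (g := fun s => ‖g‖ * ‖compLp hφ s (X s) - compLp hφ t (X t)‖)
    (fun _ => norm_nonneg _) (fun s => ?_) ?_
  · refine Lp.norm_le_mul_norm_of_ae_le_mul ?_
    filter_upwards [Lp.coeFn_sub (compMulLp hφ s (X s) W) (compMulLp hφ t (X t) W),
      coeFn_compMulLp hφ s (X s) W, coeFn_compMulLp hφ t (X t) W, coeFn_compLp hφ s (X s),
      coeFn_compLp hφ t (X t), hgW, Lp.coeFn_sub (compLp hφ s (X s)) (compLp hφ t (X t))]
      with m h1 h2 h3 h4 h5 h6 h7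
    rw [h1, Pi.sub_apply, h2, h3, h7, Pi.sub_apply, h4, h5, h6, ← sub_mul, norm_mul, mul_comm]
    exact mul_le_mul_of_nonneg_right (g.norm_coe_le_norm m) (norm_nonneg _)
  · have : Continuous fun s => ‖g‖ * ‖compLp hφ s (X s) - compLp hφ t (X t)‖ :=
      continuous_const.mul ((continuous_compLp hφ hX).sub continuous_const).norm
    simpa using this.tendsto t

/-- The derivative of `s ↦ φ (s, X s)` in `L²`, for a curve at position `X` with velocity `V`. -/
def transportDeriv (hφ : IsTestFunction φ) [IsFiniteMeasure μ] (t : ℝ) (X V : Lp ℝ 2 μ) :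
    Lp ℝ 2 μ :=
  compLp hφ.timeDeriv t X + compMulLp hφ.spaceDeriv t X V

theorem coeFn_transportDeriv (hφ : IsTestFunction φ) [IsFiniteMeasure μ] (t : ℝ) (X V : Lp ℝ 2 μ) :
    transportDeriv hφ t X V =ᵐ[μ] fun m => dt φ t (X m) + dx φ t (X m) * V m := by
  filter_upwards [Lp.coeFn_add (compLp hφ.timeDeriv t X) (compMulLp hφ.spaceDeriv t X V),
    coeFn_compLp hφ.timeDeriv t X, coeFn_compMulLp hφ.spaceDeriv t X V] with m h1 h2 h3
  rw [transportDeriv, h1, Pi.add_apply, h2, h3]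

theorem hasDerivAt_along_line (hφ : IsTestFunction φ) (t x v : ℝ) :
    HasDerivAt (fun h => φ (t + h, x + h * v)) (dt φ t x + dx φ t x * v) 0 := by
  have h1 : HasDerivAt (fun h => (t + h, x + h * v)) ((1 : ℝ), v) 0 := by
    have := ((hasDerivAt_id (0 : ℝ)).const_add t).prodMk
      (((hasDerivAt_id (0 : ℝ)).mul_const v).const_add x)
    simpa using! this
  have h2 := HasFDerivAt.comp_hasDerivAt_of_eq (0 : ℝ) (hφ.hasFDerivAt (t, x)) h1 (by simp)
  convert! h2 using 1
  rw [hφ.dt_eq, hφ.dx_eq, mul_comm, ← smul_eq_mul v, ← map_smul, ← map_add]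
  simp

/-- Along a straight line the pointwise curves `h ↦ X m + h V m` are explicit, so the chain rule
holds for each `m`; dominated convergence makes it hold in `L²`. -/
theorem hasDerivAt_compLp_line (hφ : IsTestFunction φ) [IsProbabilityMeasure μ] (t : ℝ)
    (X V : Lp ℝ 2 μ) :
    HasDerivAt (fun h : ℝ => compLp hφ (t + h) (X + h • V)) (transportDeriv hφ t X V) 0 := by
  obtain ⟨K, hK⟩ := hφ.exists_lipschitz
  rw [hasDerivAt_iff_tendsto_slope_zero]
  set D : ℝ → Lp ℝ 2 μ := fun h => h⁻¹ • (compLp hφ (t + (0 + h)) (X + (0 + h) • V) -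
    compLp hφ (t + 0) (X + (0 : ℝ) • V)) - transportDeriv hφ t X V with hD
  let d : ℝ → ℝ → ℝ := fun h m => h⁻¹ * (φ (t + h, X m + h * V m) - φ (t, X m)) -
    (dt φ t (X m) + dx φ t (X m) * V m)
  have hDd (h : ℝ) : D h =ᵐ[μ] d h := by
    filter_upwards [Lp.coeFn_sub (h⁻¹ • (compLp hφ (t + (0 + h)) (X + (0 + h) • V) -
        compLp hφ (t + 0) (X + (0 : ℝ) • V))) (transportDeriv hφ t X V),
      Lp.coeFn_smul h⁻¹ (compLp hφ (t + (0 + h)) (X + (0 + h) • V) -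
        compLp hφ (t + 0) (X + (0 : ℝ) • V)),
      Lp.coeFn_sub (compLp hφ (t + (0 + h)) (X + (0 + h) • V))
        (compLp hφ (t + 0) (X + (0 : ℝ) • V)), coeFn_compLp hφ (t + (0 + h)) (X + (0 + h) • V),
      coeFn_compLp hφ (t + 0) (X + (0 : ℝ) • V), coeFn_transportDeriv hφ t X V,
      Lp.coeFn_add X ((0 + h) • V), Lp.coeFn_smul (0 + h) V] with m h1 h2 h3 h4 h5 h6 h7 h8
    rw [hD, h1, Pi.sub_apply, h2, Pi.smul_apply, h3, Pi.sub_apply, h4, h5, h6, h7, Pi.add_apply, h8]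
    simp [d]
  have hquot (h m : ℝ) (hh : h ≠ 0) :
      |h⁻¹ * (φ (t + h, X m + h * V m) - φ (t, X m))| ≤ K * (1 + |V m|) := by
    have h1 := hK.dist_le_mul (t + h, X m + h * V m) (t, X m)
    have h2 : dist (t + h, X m + h * V m) (t, X m) ≤ |h| * (1 + |V m|) := by
      simp only [Prod.dist_eq, Real.dist_eq, add_sub_cancel_left, abs_mul]
      refine max_le ?_ ?_ <;> nlinarith [abs_nonneg h, abs_nonneg (V m)]
    rw [abs_mul, abs_inv, inv_mul_le_iff₀ (abs_pos.2 hh), ← Real.dist_eq]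
    exact h1.trans ((mul_le_mul_of_nonneg_left h2 K.2).trans_eq (mul_left_comm _ _ _))
  have hlim (m : ℝ) : Tendsto (fun h => h⁻¹ * (φ (t + h, X m + h * V m) - φ (t, X m))) (𝓝[≠] 0)
      (𝓝 (dt φ t (X m) + dx φ t (X m) * V m)) := by
    simpa using (hasDerivAt_iff_tendsto_slope_zero.1 (hasDerivAt_along_line hφ t (X m) (V m)))
  have hw (m : ℝ) : |dt φ t (X m) + dx φ t (X m) * V m| ≤ K * (1 + |V m|) :=
    le_of_tendsto (hlim m).abs (eventually_mem_nhdsWithin.mono fun h hh => hquot h m hh)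
  -- The quotient and its limit are each bounded by `K (1 + |V|)`, hence the factor `2`; the square
  -- is integrable because `V ∈ L²`.
  have hbi : Integrable (fun m => (2 * (K * (1 + |V m|))) ^ 2) μ :=
    ((((memLp_const (1 : ℝ)).add (Lp.memLp V).abs).const_mul (K : ℝ)).const_mul 2).integrable_sq
  have hint : Tendsto (fun h => ∫ m, d h m ^ 2 ∂μ) (𝓝[≠] 0) (𝓝 (∫ _, (0 : ℝ) ∂μ)) := by
    refine tendsto_integral_filter_of_dominated_convergence _ ?_ ?_ hbi ?_
    · exact Eventually.of_forall fun h =>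
        (((Lp.stronglyMeasurable (D h)).aestronglyMeasurable).congr (hDd h)).pow 2
    · refine eventually_mem_nhdsWithin.mono fun h hh => Eventually.of_forall fun m => ?_
      rw [Real.norm_eq_abs, abs_pow]
      refine pow_le_pow_left₀ (abs_nonneg _) ?_ 2
      have := abs_sub (h⁻¹ * (φ (t + h, X m + h * V m) - φ (t, X m)))
        (dt φ t (X m) + dx φ t (X m) * V m)
      linarith [hquot h m hh, hw m]
    · refine Eventually.of_forall fun m => ?_
      simpa using ((hlim m).sub_const (dt φ t (X m) + dx φ t (X m) * V m)).pow 2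
  have hnorm (h : ℝ) : ‖D h‖ ^ 2 = ∫ m, d h m ^ 2 ∂μ := by
    rw [← real_inner_self_eq_norm_sq, L2.inner_def]
    refine integral_congr_ae ?_
    filter_upwards [hDd h] with m hm
    simp [hm, sq]
  rw [tendsto_iff_norm_sub_tendsto_zero]
  have h2 : Tendsto (fun h => ‖D h‖ ^ 2) (𝓝[≠] 0) (𝓝 0) := by
    simp_rw [hnorm]; simpa using hint
  simpa only [Real.sqrt_sq (norm_nonneg _), Real.sqrt_zero] using h2.sqrt

/-- The chain rule in `L²` for the composition of a curve with a test function. -/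
theorem hasDerivAt_compLp (hφ : IsTestFunction φ) [IsProbabilityMeasure μ] {X : ℝ → Lp ℝ 2 μ}
    {V : Lp ℝ 2 μ} {t : ℝ}
    (hV : HasDerivAt X V t) :
    HasDerivAt (fun s => compLp hφ s (X s)) (transportDeriv hφ t (X t) V) t := by
  obtain ⟨K, hK⟩ := hφ.exists_lipschitz
  have h1 := hasDerivAt_iff_isLittleO_nhds_zero.1 (hasDerivAt_compLp_line hφ t (X t) V)
  have h2 := hasDerivAt_iff_isLittleO_nhds_zero.1 hV
  rw [hasDerivAt_iff_isLittleO_nhds_zero]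
  -- Replacing the curve by its tangent line costs at most `K` times the `o(h)` remainder, as
  -- composition with `φ` is Lipschitz in `L²`.
  have h3 : (fun h => compLp hφ (t + h) (X (t + h)) - compLp hφ (t + h) (X t + h • V))
      =o[𝓝 0] fun h => h := by
    refine Asymptotics.IsBigO.trans_isLittleO ?_ h2
    refine Asymptotics.IsBigO.of_bound K (Eventually.of_forall fun h => ?_)
    refine (norm_compLp_sub_le hφ hK _ _ _ _).trans ?_
    simp [sub_sub]
  refine (h3.add h1).congr_left fun h => ?_
  simp only [zero_add, add_zero, zero_smul]
  abel

theorem compLp_mem_closedSpan (hφ : IsTestFunction φ) [IsFiniteMeasure μ] (t : ℝ) (X : Lp ℝ 2 μ) :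
    compLp hφ t X ∈ closedSpan X :=
  Submodule.le_topologicalClosure _
    ⟨_, hφ.contDiff_slice t, hφ.hasCompactSupport_slice t, coeFn_compLp hφ t X⟩

theorem compMulLp_mem_closedSpan (hφ : IsTestFunction φ) [IsFiniteMeasure μ] (t : ℝ)
    {X W : Lp ℝ 2 μ} {v : ℝ → ℝ}
    (hv : MemLp v 2 (μ.map X)) (hW : W =ᵐ[μ] v ∘ X) : compMulLp hφ t X W ∈ closedSpan X := by
  obtain ⟨C, hC⟩ := hφ.exists_bound
  refine mem_closedSpan_of_ae_eq_comp (v := fun x => φ (t, x) * v x) ?_ ?_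
  · refine MemLp.of_le_mul (c := C) hv (((hφ.contDiff_slice t).continuous.aestronglyMeasurable).mul
      hv.aestronglyMeasurable) (Eventually.of_forall fun m => ?_)
    rw [norm_mul]
    exact mul_le_mul_of_nonneg_right (hC _) (norm_nonneg _)
  · filter_upwards [coeFn_compMulLp hφ t X W, hW] with m h1 h2
    rw [h1, h2]; rfl

theorem transportDeriv_mem_closedSpan (hφ : IsTestFunction φ) [IsFiniteMeasure μ] (t : ℝ)
    {X V : Lp ℝ 2 μ} {v : ℝ → ℝ}
    (hv : MemLp v 2 (μ.map X)) (hV : V =ᵐ[μ] v ∘ X) :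
    transportDeriv hφ t X V ∈ closedSpan X :=
  add_mem (compLp_mem_closedSpan hφ.timeDeriv t X) (compMulLp_mem_closedSpan hφ.spaceDeriv t hv hV)

end Composition

/-! ### The velocity as an orthogonal projection. -/

/-- The velocity of a projected straight line is the projection of the initial velocity onto the
functions of the position. -/
theorem deriv_eq_starProjection {μ : Measure ℝ} [IsProbabilityMeasure μ] {X : ℝ → Lp ℝ 2 μ}
    {Y U V : Lp ℝ 2 μ} (hX : ∀ s, IsMetricProj (monotoneCone μ) (Y + s • U) (X s)) {t : ℝ}
    (hV : HasDerivAt X V t) : V = (closedSpan (X t)).starProjection U := by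
  obtain ⟨v, hv, hVv⟩ := exists_memLp_comp_of_hasDerivAt (fun s => (hX s).1) hV
  have horth : closedSpan (X t) ≤ (ℝ ∙ (U - V))ᗮ := by
    refine Submodule.topologicalClosure_minimal _ ?_ (Submodule.isClosed_orthogonal _)
    rintro W ⟨ψ, hψ, hψc, hW⟩
    rw [Submodule.mem_orthogonal_singleton_iff_inner_right]
    -- A cutoff in time equal to `1` near `t` turns `ψ` into a compactly supported test function of
    -- `(s, x)`.
    let χ : ContDiffBump t := ⟨1, 2, by norm_num, by norm_num⟩
    have hφ := isTestFunction_mul χ.contDiff χ.hasCompactSupport hψ hψc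
    have hWF : W = compLp hφ t (X t) := by
      refine Lp.ext ?_
      filter_upwards [hW, coeFn_compLp hφ t (X t)] with m h1 h2
      rw [h1, h2, χ.one_of_mem_closedBall (Metric.mem_closedBall_self χ.rIn_pos.le), one_mul]
    have h0 : ∀ s, inner ℝ (Y + s • U - X s) (compLp hφ s (X s)) = 0 := fun s =>
      inner_eq_zero_of_isMetricProj (hX s) (compLp_mem_closedSpan hφ s (X s))
    have hR : HasDerivAt (fun s : ℝ => Y + s • U - X s) (U - V) t := by
      simpa using! (((hasDerivAt_id t).smul_const U).const_add Y).sub hV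
    have h1 := hR.inner ℝ (hasDerivAt_compLp hφ hV)
    -- The pairing vanishes for all `s`, so its derivative does. By the product rule this is the sum
    -- of a term with `transportDeriv`, zero because `V` is a function of `X t`, and the inner
    -- product of `U - V` with `ψ ∘ X t`.
    simp_rw [h0] at h1
    have h2 := h1.unique (hasDerivAt_const t (0 : ℝ))
    rw [inner_eq_zero_of_isMetricProj (hX t) (transportDeriv_mem_closedSpan hφ t hv hVv),
      zero_add] at h2
    rw [hWF, h2]
  refine (Submodule.eq_starProjection_of_mem_of_inner_eq_zero
    (mem_closedSpan_of_ae_eq_comp hv hVv) fun W hW => ?_).symm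
  exact (Submodule.mem_orthogonal_singleton_iff_inner_right).1 (horth hW)

/-! ### Weak formulation of the gas dynamics equations. -/

section Weak

variable {μ : Measure ℝ} {φ : ℝ × ℝ → ℝ}

instance [IsFiniteMeasure μ] : SecondCountableTopology (Lp ℝ 2 μ) :=
  have : Fact ((2 : ENNReal) ≠ ⊤) := ⟨ENNReal.ofNat_ne_top⟩
  inferInstance

theorem integrableOn_Ioi_of_bounded_of_eq_zero {f : ℝ → ℝ} (hf : AEStronglyMeasurable f)
    {C T : ℝ} (hC : ∀ t, ‖f t‖ ≤ C) (hT : ∀ t, T ≤ |t| → f t = 0) : IntegrableOn f (Ioi 0) := by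
  refine IntegrableOn.of_forall_sdiff_eq_zero (s := Ioc 0 T) ?_ measurableSet_Ioi fun t ht => ?_
  · exact Measure.integrableOn_of_bounded (M := C) measure_Ioc_lt_top.ne hf
      (Eventually.of_forall hC)
  · have h1 : T < t := by
      by_contra! h
      exact ht.2 ⟨ht.1, h⟩
    exact hT t (h1.le.trans (le_abs_self t))

theorem compLp_eq_zero [IsFiniteMeasure μ] (hφ : IsTestFunction φ) {t : ℝ}
    (ht : ∀ x, φ (t, x) = 0) (X : Lp ℝ 2 μ) :
    compLp hφ t X = 0 := by
  refine Lp.ext ?_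
  filter_upwards [coeFn_compLp hφ t X, Lp.coeFn_zero ℝ 2 μ] with m h1 h2
  rw [h1, h2, ht, Pi.zero_apply]

theorem compMulLp_eq_zero (hφ : IsTestFunction φ) {t : ℝ} (ht : ∀ x, φ (t, x) = 0)
    (X W : Lp ℝ 2 μ) : compMulLp hφ t X W = 0 := by
  refine Lp.ext ?_
  filter_upwards [coeFn_compMulLp hφ t X W, Lp.coeFn_zero ℝ 2 μ] with m h1 h2
  rw [h1, h2, ht, zero_mul, Pi.zero_apply]

/-- Integration of the chain rule in time, against a fixed function in `L²`. -/
theorem integral_inner_transportDeriv [IsProbabilityMeasure μ] (hφ : IsTestFunction φ)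
    {X : ℝ → Lp ℝ 2 μ} {L : ℝ≥0}
    (hX : LipschitzWith L X) (g : Lp ℝ 2 μ) :
    ∫ t in Ioi (0 : ℝ), inner ℝ (transportDeriv hφ t (X t) (deriv X t)) g =
      -inner ℝ (compLp hφ 0 (X 0)) g := by
  obtain ⟨K, hK⟩ := hφ.exists_lipschitz
  obtain ⟨T, hT0, hT⟩ := hφ.exists_time_bound
  set f : ℝ → ℝ := fun t => inner ℝ (compLp hφ t (X t)) g with hf
  have hflip : LipschitzWith ((K + K * L) * ‖g‖₊) f := by
    refine LipschitzWith.of_dist_le_mul fun s t => ?_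
    rw [Real.dist_eq, hf, ← inner_sub_left]
    refine (abs_real_inner_le_norm _ _).trans ?_
    have h1 := norm_compLp_sub_le hφ hK s t (X s) (X t)
    have h2 := hX.dist_le_mul s t
    rw [dist_eq_norm] at h2
    push_cast
    calc ‖compLp hφ s (X s) - compLp hφ t (X t)‖ * ‖g‖
        ≤ (K * dist s t + K * (L * dist s t)) * ‖g‖ := by
          gcongr
          exact h1.trans (by rw [Real.dist_eq] at h2 ⊢; gcongr)
      _ = (K + K * L) * ‖g‖ * dist s t := by ring
  have hzero : ∀ t, T ≤ |t| → f t = 0 := fun t ht => by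
    rw [hf]; simp only [compLp_eq_zero hφ (fun x => hT t x ht), inner_zero_left]
  have hder : ∀ᵐ t, deriv f t = inner ℝ (transportDeriv hφ t (X t) (deriv X t)) g := by
    filter_upwards [ae_differentiableAt_of_lipschitzWith hX] with t ht
    have := (hasDerivAt_compLp hφ ht.hasDerivAt).inner ℝ (hasDerivAt_const t g)
    simpa using this.deriv
  rw [← integral_congr_ae (ae_restrict_of_ae hder)]
  have hIoc : ∫ t in Ioi (0 : ℝ), deriv f t = ∫ t in Ioc 0 T, deriv f t := by
    refine setIntegral_eq_of_subset_of_forall_sdiff_eq_zero measurableSet_Ioi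
      (fun t ht => ht.1) fun t ht => ?_
    have h1 : T < t := by
      by_contra! h
      exact ht.2 ⟨ht.1, h⟩
    have h2 : f =ᶠ[𝓝 t] fun _ => 0 := by
      filter_upwards [lt_mem_nhds h1] with s hs using hzero s (hs.le.trans (le_abs_self s))
    rw [h2.deriv_eq, deriv_const]
  rw [hIoc, ← intervalIntegral.integral_of_le hT0.le,
    ((hflip.lipschitzOnWith (s := uIcc 0 T)).absolutelyContinuousOnInterval).integral_deriv_eq_sub,
    hzero T (le_abs_self T), zero_sub]

theorem inner_eq_integral_mul (f g : Lp ℝ 2 μ) : inner ℝ f g = ∫ m, f m * g m ∂μ := by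
  rw [L2.inner_def]
  simp [mul_comm]

theorem inner_toLp_one [IsFiniteMeasure μ] (f : Lp ℝ 2 μ) :
    inner ℝ f ((memLp_const (1 : ℝ)).toLp fun _ => (1 : ℝ)) = ∫ m, f m ∂μ := by
  rw [inner_eq_integral_mul]
  refine integral_congr_ae ?_
  filter_upwards [(memLp_const (1 : ℝ) (μ := μ) (p := 2)).coeFn_toLp] with m h
  rw [h, mul_one]

theorem integral_map_coeFn (X : Lp ℝ 2 μ) {f : ℝ → ℝ} (hf : AEStronglyMeasurable f (μ.map X)) :
    ∫ x, f x ∂(μ.map X) = ∫ m, f (X m) ∂μ :=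
  integral_map (measurable_coeFn X).aemeasurable hf

/-- A Lipschitz curve of maps whose velocity is at almost every time a function of the position,
and is the projection of the initial velocity `U = v₀ ∘ X 0`, generates a weak solution of the
pressureless gas dynamics equations. -/
theorem isWeakSolution_of_lipschitzWith [IsProbabilityMeasure μ] {X : ℝ → Lp ℝ 2 μ} {L : ℝ≥0}
    (hX : LipschitzWith L X)
    {v : ℝ → ℝ → ℝ}
    (hv : ∀ᵐ t : ℝ, MemLp (v t) 2 (μ.map (X t)) ∧ (deriv X t : Lp ℝ 2 μ) =ᵐ[μ] v t ∘ X t)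
    {U : Lp ℝ 2 μ} (hU : ∀ᵐ t : ℝ, deriv X t = (closedSpan (X t)).starProjection U)
    {ϱ₀ : Measure ℝ} (hX₀ : MeasurePreserving (X 0) μ ϱ₀) {v₀ : ℝ → ℝ} (hv₀ : MemLp v₀ 2 ϱ₀)
    (hUv : U =ᵐ[μ] v₀ ∘ X 0) : IsWeakSolution (fun t => μ.map (X t)) v ϱ₀ v₀ := by
  have hslice {ψ : ℝ × ℝ → ℝ} (hψ : IsTestFunction ψ) (t : ℝ) :
      AEStronglyMeasurable (fun x => ψ (t, x)) (μ.map (X t)) :=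
    (hψ.contDiff_slice t).continuous.aestronglyMeasurable
  have hVm : StronglyMeasurable (deriv X) := stronglyMeasurable_deriv X
  have hVL (t : ℝ) : ‖deriv X t‖ ≤ L := norm_deriv_le_of_lipschitz hX
  refine ⟨fun t _ => Measure.isProbabilityMeasure_map (measurable_coeFn _).aemeasurable,
    ae_restrict_of_ae (hv.mono fun t ht => ht.1), fun φ hφ k hk => ?_, fun φ hφ => ?_,
    fun φ hφ => ?_⟩
  · obtain ⟨T, -, hT⟩ := hφ.exists_time_bound
    obtain ⟨C, hC⟩ := hφ.exists_bound
    interval_cases k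
    · have h0 : (fun t => ∫ x, φ (t, x) * v t x ^ 0 ∂(μ.map (X t))) =
          fun t => inner ℝ (compLp hφ t (X t)) ((memLp_const (1 : ℝ)).toLp fun _ => (1 : ℝ)) := by
        funext t
        simp only [pow_zero, mul_one]
        rw [integral_map_coeFn _ (hslice hφ t), inner_toLp_one]
        exact (integral_congr_ae (coeFn_compLp hφ t (X t))).symm
      rw [h0]
      refine integrableOn_Ioi_of_bounded_of_eq_zero (C := C) (T := T) ?_
          (fun t => ?_) fun t ht => ?_
      · exact ((continuous_compLp hφ hX.continuous).inner continuous_const).aestronglyMeasurable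
      · rw [inner_toLp_one, integral_congr_ae (coeFn_compLp hφ t (X t))]
        have := norm_integral_le_of_norm_le_const (μ := μ) (f := fun m => φ (t, X t m)) (C := C)
          (Eventually.of_forall fun m => hC (t, X t m))
        simpa using this
      · rw [compLp_eq_zero hφ (fun x => hT t x ht), inner_zero_left]
    · have h1 : ∀ᵐ t, inner ℝ (compMulLp hφ t (X t) (deriv X t))
          ((memLp_const (1 : ℝ)).toLp fun _ => (1 : ℝ)) =
          ∫ x, φ (t, x) * v t x ^ 1 ∂(μ.map (X t)) := by
        filter_upwards [hv] with t ⟨hvt, hVv⟩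
        simp only [pow_one]
        rw [integral_map_coeFn _ (f := fun x => φ (t, x) * v t x)
          ((hslice hφ t).mul hvt.aestronglyMeasurable), inner_toLp_one]
        refine integral_congr_ae ?_
        filter_upwards [coeFn_compMulLp hφ t (X t) (deriv X t), hVv] with m h1 h2
        rw [h1, h2]; rfl
      -- No measurability of `v` in time is assumed: measurability of the pairing comes from its
      -- Lagrangian form, built from `deriv X`, with which it agrees for a.e. `t`.
      refine IntegrableOn.congr_fun_ae ?_ (ae_restrict_of_ae h1)
      refine integrableOn_Ioi_of_bounded_of_eq_zero
        (C := C * L * ‖(memLp_const (1 : ℝ) (μ := μ) (p := 2)).toLp fun _ => (1 : ℝ)‖) (T := T)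
        ?_ (fun t => ?_) fun t ht => ?_
      · exact (((continuous_compMulLp hφ hX.continuous).comp_stronglyMeasurable
          (hVm.prodMk stronglyMeasurable_id)).inner stronglyMeasurable_const).aestronglyMeasurable
      · refine (norm_inner_le_norm _ _).trans (mul_le_mul_of_nonneg_right ?_ (norm_nonneg _))
        exact (norm_compMulLp_le hφ hC _ _ _).trans (mul_le_mul_of_nonneg_left (hVL t) C.2)
      · rw [compMulLp_eq_zero hφ (fun x => hT t x ht), inner_zero_left]
    · have h2 : ∀ᵐ t, inner ℝ (compMulLp hφ t (X t) (deriv X t)) (deriv X t) =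
          ∫ x, φ (t, x) * v t x ^ 2 ∂(μ.map (X t)) := by
        filter_upwards [hv] with t ⟨hvt, hVv⟩
        rw [integral_map_coeFn _ (f := fun x => φ (t, x) * v t x ^ 2)
          ((hslice hφ t).mul (hvt.aestronglyMeasurable.pow 2)),
          inner_eq_integral_mul]
        refine integral_congr_ae ?_
        filter_upwards [coeFn_compMulLp hφ t (X t) (deriv X t), hVv] with m h1 h2
        rw [h1, h2, Function.comp_apply]; ring
      refine IntegrableOn.congr_fun_ae ?_ (ae_restrict_of_ae h2)
      refine integrableOn_Ioi_of_bounded_of_eq_zero (C := C * L * L) (T := T)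
        ?_ (fun t => ?_) fun t ht => ?_
      · exact (((continuous_compMulLp hφ hX.continuous).comp_stronglyMeasurable
          (hVm.prodMk stronglyMeasurable_id)).inner hVm).aestronglyMeasurable
      · refine (norm_inner_le_norm _ _).trans ?_
        have := (norm_compMulLp_le hφ hC t (X t) (deriv X t)).trans
          (mul_le_mul_of_nonneg_left (hVL t) C.2)
        exact mul_le_mul this (hVL t) (norm_nonneg _) (by positivity)
      · rw [compMulLp_eq_zero hφ (fun x => hT t x ht), inner_zero_left]
  · have h0 : ∫ x, φ (0, x) ∂ϱ₀ =
        inner ℝ (compLp hφ 0 (X 0)) ((memLp_const (1 : ℝ)).toLp fun _ => (1 : ℝ)) := by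
      rw [← hX₀.map_eq, integral_map_coeFn _ (hslice hφ 0), inner_toLp_one]
      exact (integral_congr_ae (coeFn_compLp hφ 0 (X 0))).symm
    -- Conservation of mass is the integrated chain rule tested against the constant `1`.
    rw [h0, ← integral_inner_transportDeriv hφ hX]
    refine integral_congr_ae (ae_restrict_of_ae ?_)
    filter_upwards [hv] with t ⟨hvt, hVv⟩
    rw [integral_map_coeFn _ (f :=
        fun x => dt φ t x + v t x * dx φ t x) ((hslice hφ.timeDeriv t).add
      (hvt.aestronglyMeasurable.mul (hslice hφ.spaceDeriv t))), inner_toLp_one]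
    refine integral_congr_ae ?_
    filter_upwards [coeFn_transportDeriv hφ t (X t) (deriv X t), hVv] with m h1 h2
    rw [h1, h2, mul_comm]; rfl
  · have h0 : ∫ x, φ (0, x) * v₀ x ∂ϱ₀ = inner ℝ (compLp hφ 0 (X 0)) U := by
      rw [← hX₀.map_eq] at hv₀ ⊢
      rw [integral_map_coeFn _ (f :=
          fun x => φ (0, x) * v₀ x) ((hslice hφ 0).mul hv₀.aestronglyMeasurable),
        inner_eq_integral_mul]
      refine integral_congr_ae ?_
      filter_upwards [coeFn_compLp hφ 0 (X 0), hUv] with m h1 h2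
      rw [h1, h2]; rfl
    rw [h0, ← integral_inner_transportDeriv hφ hX]
    refine integral_congr_ae (ae_restrict_of_ae ?_)
    filter_upwards [hv, hU] with t ⟨hvt, hVv⟩ hUt
    have hmem := transportDeriv_mem_closedSpan hφ t hvt hVv
    -- Here the fixed `U` becomes the current velocity: `U - deriv X t` is orthogonal to the closed
    -- span, which contains the transport derivative.
    have hproj : inner ℝ (transportDeriv hφ t (X t) (deriv X t)) U =
        inner ℝ (transportDeriv hφ t (X t) (deriv X t)) (deriv X t) := by
      have := Submodule.starProjection_inner_eq_zero (K := closedSpan (X t)) U _ hmem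
      rw [← hUt, inner_sub_left, sub_eq_zero] at this
      rw [real_inner_comm, this, real_inner_comm]
    rw [hproj, integral_map_coeFn _
      (f := fun x => (dt φ t x + v t x * dx φ t x) * v t x) (((hslice hφ.timeDeriv t).add
      (hvt.aestronglyMeasurable.mul (hslice hφ.spaceDeriv t))).mul hvt.aestronglyMeasurable),
      inner_eq_integral_mul]
    refine integral_congr_ae ?_
    filter_upwards [coeFn_transportDeriv hφ t (X t) (deriv X t), hVv] with m h1 h2
    rw [h1, h2, Function.comp_apply]; ring

end Weak

/-- Every measure is transported onto itself by the identity, which is a monotone map. -/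
theorem exists_monotone_transport {ϱ₀ : Measure ℝ} (hϱ₀ : IsP2 ϱ₀) :
    ∃ X ∈ monotoneCone ϱ₀, MeasurePreserving X ϱ₀ ϱ₀ := by
  have hid : MemLp (fun x : ℝ => x) 2 ϱ₀ :=
    (memLp_two_iff_integrable_sq aestronglyMeasurable_id).2 hϱ₀.secondMoment
  have hX := hid.coeFn_toLp
  refine ⟨hid.toLp, mem_monotoneCone_of_ae_eq hX univ_mem (monotone_id.monotoneOn _),
    measurable_coeFn _, ?_⟩
  rw [Measure.map_congr hX]
  exact Measure.map_id

end PGD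

end

theorem theorem3p3 (ϱ₀ : Measure ℝ) (hϱ₀ : PGD.IsP2 ϱ₀) (v₀ : ℝ → ℝ) (hv₀ : MemLp v₀ 2 ϱ₀) :
    -- some reference measure and monotone transport map exist
    (∃ μ : Measure ℝ, PGD.IsP2 μ ∧ ∃ X₀ ∈ PGD.monotoneCone μ, MeasurePreserving X₀ μ ϱ₀) ∧
    ∀ (μ : Measure ℝ), PGD.IsP2 μ → ∀ X₀ ∈ PGD.monotoneCone μ,
      ∀ hX₀ : MeasurePreserving X₀ μ ϱ₀,
      -- the monotone transport map is unique
      (∀ Y ∈ PGD.monotoneCone μ, MeasurePreserving Y μ ϱ₀ → Y = X₀) ∧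
      -- `X t` is the metric projection of `X₀ + t V₀` with `V₀ = v₀ ∘ X₀`
      ∃ X : ℝ → Lp ℝ 2 μ,
        (∀ (t : ℝ) (Z : Lp ℝ 2 μ),
          PGD.IsMetricProj (PGD.monotoneCone μ)
            (X₀ + t • PGD.lagrangianVelocity X₀ hX₀ hv₀) Z ↔ Z = X t) ∧
        (∀ᵐ t : ℝ, DifferentiableAt ℝ X t ∧
          deriv X t = (PGD.closedSpan (X t)).starProjection
            (PGD.lagrangianVelocity X₀ hX₀ hv₀)) ∧
        ∃ v : ℝ → ℝ → ℝ,
          (∀ᵐ t : ℝ, MemLp (v t) 2 (μ.map (X t)) ∧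
            ((deriv X t : Lp ℝ 2 μ) : ℝ → ℝ) =ᵐ[μ] v t ∘ X t) ∧
          PGD.IsWeakSolution (fun t => μ.map (X t)) v ϱ₀ v₀ := by
  refine ⟨⟨ϱ₀, hϱ₀, PGD.exists_monotone_transport hϱ₀⟩, fun μ hμ X₀ hX₀C hX₀ => ?_⟩
  have := hμ.isProbabilityMeasure
  refine ⟨fun Y hY hYm => PGD.eq_of_mem_monotoneCone_of_map_eq hY hX₀C
    (hYm.map_eq.trans hX₀.map_eq.symm), ?_⟩
  set U := PGD.lagrangianVelocity X₀ hX₀ hv₀ with hU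
  have hUv : U =ᵐ[μ] v₀ ∘ X₀ := (hv₀.comp_measurePreserving hX₀).coeFn_toLp
  choose X hX using fun t : ℝ => PGD.exists_isMetricProj PGD.convex_monotoneCone
    PGD.isClosed_monotoneCone ⟨0, PGD.zero_mem_monotoneCone⟩ (X₀ + t • U)
  have hXp (t : ℝ) : PGD.IsMetricProj (PGD.monotoneCone μ) (X₀ + t • U) (X t) := (hX t _).2 rfl
  have hX0 : X 0 = X₀ := by
    refine ((hX 0 X₀).1 ?_).symm
    rw [zero_smul, add_zero]
    exact PGD.isMetricProj_self hX₀C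
  -- The projected points `X₀ + t U` move along a line with speed `‖U‖`, and projection does not
  -- increase distances.
  have hlip : LipschitzWith ‖U‖₊ X := LipschitzWith.of_dist_le_mul fun s t => by
    rw [dist_eq_norm, Real.dist_eq]
    refine ((hXp s).norm_sub_le PGD.convex_monotoneCone (hXp t)).trans_eq ?_
    rw [add_sub_add_left_eq_sub, ← sub_smul, norm_smul, mul_comm, Real.norm_eq_abs, coe_nnnorm]
  have hdiff : ∀ᵐ t : ℝ, DifferentiableAt ℝ X t ∧
      deriv X t = (PGD.closedSpan (X t)).starProjection U := by
    filter_upwards [PGD.ae_differentiableAt_of_lipschitzWith hlip] with t ht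
    exact ⟨ht, PGD.deriv_eq_starProjection hXp ht.hasDerivAt⟩
  have hex (t : ℝ) : ∃ v : ℝ → ℝ, DifferentiableAt ℝ X t →
      MemLp v 2 (μ.map (X t)) ∧ (deriv X t : Lp ℝ 2 μ) =ᵐ[μ] v ∘ X t := by
    by_cases ht : DifferentiableAt ℝ X t
    · obtain ⟨v, hv⟩ := PGD.exists_memLp_comp_of_hasDerivAt (fun s => (hXp s).1) ht.hasDerivAt
      exact ⟨v, fun _ => hv⟩
    -- At times of non-differentiability, a null set, the value of `v` is irrelevant.
    · exact ⟨0, fun h => absurd h ht⟩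
  choose v hv using hex
  have hvae : ∀ᵐ t : ℝ, MemLp (v t) 2 (μ.map (X t)) ∧
      (deriv X t : Lp ℝ 2 μ) =ᵐ[μ] v t ∘ X t := hdiff.mono fun t ht => hv t ht.1
  refine ⟨X, hX, hdiff, v, hvae, ?_⟩
  rw [← hX0] at hX₀ hUv
  exact PGD.isWeakSolution_of_lipschitzWith hlip hvae (hdiff.mono fun t ht => ht.2) hX₀ hv₀ hUv
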